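/- All representations are over $\mathbb{C}$. For a partition $\lambda\vdash n$ let $\chi_\lambda$ denote the irreducible representation of the symmetric group $S_n$ indexed by $\lambda$ (the Specht module). For representations $V,W$ of a finite group, $V\le W$ means that $V$ is isomorphic to a subrepresentation of $W$. Let $w_n=(1\,2\,\cdots\,n)\in S_n$, and let $D_n=\langle w_n,\,(1\;n)(2\;n-1)(3\;n-2)\cdots\rangle\le S_n$ be the dihedral subgroup of order $2n$. Let $n=mp$ be an odd positive integer, where $p$ is a prime and $m>1$. Embed $S_m^{\times p}$ in $S_n$ as a Young subgroup, that is, as the product of the symmetric groups on the blocks of a partition of $\{1,\dots,n\}$ into $p$ blocks of size $m$, each block being identified with $\{1,\dots,m\}$; all these embeddings are conjugate in $S_n$, and in the hypothesis below any one of them may be taken. When the blocks are the residue classes modulo $p$ and $i\in\{1,\dots,m\}$ corresponds to $j+(i-1)p$ in the class of $j\in\{1,\dots,p\}$, the element $w_n^p$ is the image of $(w_m,\dots,w_m)$; restriction from $S_m^{\times p}$ to $\langle w_n^p\rangle$ is understood along the resulting inclusion $\langle w_n^p\rangle\hookrightarrow S_m^{\times p}$, $w_n^p\mapsto(w_m,\dots,w_m)$.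 Let $\mu^1,\dots,\mu^p$ be partitions of $m$ at least three of which are pairwise distinct, and let $\Psi=\chi_{\mu^1}\times\cdots\times\chi_{\mu^p}$ be the outer tensor product, a representation of $S_m^{\times p}$. Let $\lambda\vdash n$ satisfy $$\Psi\le\operatorname{Res}^{S_n}_{S_m^{\times p}}\chi_\lambda .$$ Then $$\operatorname{Ind}_{\langle w_n^p\rangle}^{D_n}\operatorname{Res}^{S_m^{\times p}}_{\langle w_n^p\rangle}\Psi\;\le\;\operatorname{Res}^{S_n}_{D_n}\chi_\lambda .$$ -/

import Mathlib

noncomputable section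

namespace DihedralRes

open Equiv

/-! ### Generalities on representations -/

/-- `ρ ≤ σ` for representations of the same group: `ρ` is (isomorphic to) a subrepresentation
of `σ`, i.e. there is an injective linear map from `ρ` to `σ` commuting with the actions. -/
def IsContained {G V W : Type*} [Group G] [AddCommGroup V] [Module ℂ V]
    [AddCommGroup W] [Module ℂ W]
    (ρ : Representation ℂ G V) (σ : Representation ℂ G W) : Prop :=
  ∃ f : Representation.IntertwiningMap ρ σ, Function.Injective f

/-- The restriction of a representation of `G` along a homomorphism `φ : H → G`. -/
def res {G H V : Type*} [Group G] [Group H] [AddCommGroup V] [Module ℂ V] (φ : H →* G)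
    (ρ : Representation ℂ G V) : Representation ℂ H V :=
  MonoidHom.comp ρ φ

/-- The outer tensor product `ρ₁ × ⋯ × ρ_p`, a representation of `G₁ × ⋯ × G_p`. -/
def outerTensor {ι : Type*} {G V : ι → Type*} [∀ i, Group (G i)]
    [∀ i, AddCommGroup (V i)] [∀ i, Module ℂ (V i)]
    (ρ : ∀ i, Representation ℂ (G i) (V i)) :
    Representation ℂ (∀ i, G i) (PiTensorProduct ℂ V) where
  toFun g := PiTensorProduct.map fun i => ρ i (g i)
  map_one' := by
    simp only [Pi.one_apply, map_one]
    exact PiTensorProduct.map_one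
  map_mul' g h := by
    simp only [Pi.mul_apply, map_mul]
    exact PiTensorProduct.map_mul _ _

/-! ### Specht modules -/

/-- The Young diagram of a partition, in English convention: the cells `(row, column)`, counted
from `0`, where the row lengths are the parts in weakly decreasing order. -/
def diagram {n : ℕ} (lam : n.Partition) : YoungDiagram :=
  YoungDiagram.ofRowLens (lam.parts.sort (· ≥ ·)) (lam.parts.pairwise_sort (· ≥ ·)).sortedGE

/-- Tableaux of shape `lam`: bijective fillings of the cells by the `n` letters. -/
abbrev Tableau {n : ℕ} (lam : n.Partition) : Type := (diagram lam).cells ≃ Fin n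

namespace Tableau

variable {n : ℕ} {lam : n.Partition}

/-- The row of `T` containing the letter `x`. The function `row T` determines, and is determined
by, the row equivalence class (tabloid) of `T`. -/
def row (T : Tableau lam) (x : Fin n) : ℕ := (T.symm x).1.1

/-- The column of `T` containing the letter `x`. -/
def col (T : Tableau lam) (x : Fin n) : ℕ := (T.symm x).1.2

/-- The column stabilizer of `T`. -/
def colStab (T : Tableau lam) : Finset (Perm (Fin n)) :=
  Finset.univ.filter fun q => ∀ x, col T (q x) = col T x

/-- The polytabloid `e_T = ∑ sgn(q) q{T}`, the sum over `q` in the column stabilizer of `T`.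
A tabloid is encoded by its row function, on which `q` acts by `f ↦ f ∘ q⁻¹`. -/
def polytabloid (T : Tableau lam) : (Fin n → ℕ) →₀ ℂ :=
  ∑ q ∈ colStab T,
    ((Perm.sign q : ℤ) : ℂ) • Finsupp.single (row T ∘ ((q⁻¹ : Perm (Fin n)) : Fin n → Fin n)) 1

end Tableau

/-- The permutation representation of `S_n` on formal combinations of functions `[n] → ℕ`
(encoding tabloids through their row functions): `σ` sends `f` to `f ∘ σ⁻¹`. -/
def tabloidRep (n : ℕ) : Representation ℂ (Perm (Fin n)) ((Fin n → ℕ) →₀ ℂ) where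
  toFun σ := Finsupp.lmapDomain ℂ ℂ fun f : Fin n → ℕ => f ∘ ((σ⁻¹ : Perm (Fin n)) : Fin n → Fin n)
  map_one' := by
    ext f : 2
    simp
  map_mul' σ τ := by
    ext f : 2
    simp [Function.comp_assoc]

/-- The Specht module of shape `lam`: the span of all polytabloids. -/
def specht {n : ℕ} (lam : n.Partition) : Submodule ℂ ((Fin n → ℕ) →₀ ℂ) :=
  Submodule.span ℂ (Set.range (Tableau.polytabloid (lam := lam)))

theorem tabloidRep_polytabloid {n : ℕ} {lam : n.Partition} (σ : Perm (Fin n)) (T : Tableau lam) :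
    tabloidRep n σ (Tableau.polytabloid T) = Tableau.polytabloid (lam := lam) (T.trans σ) := by
  have hcol : ∀ x, Tableau.col (lam := lam) (T.trans σ) x = Tableau.col T (σ⁻¹ x) := fun _ => rfl
  have hrow : Tableau.row (lam := lam) (T.trans σ) = Tableau.row T ∘ ⇑(σ⁻¹) := rfl
  unfold Tableau.polytabloid
  rw [map_sum]
  refine Finset.sum_bij' (fun q _ => σ * q * σ⁻¹) (fun q _ => σ⁻¹ * q * σ) ?_ ?_ ?_ ?_ ?_
  · intro q hq
    simp only [Tableau.colStab, Finset.mem_filter, Finset.mem_univ, true_and] at hq ⊢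
    intro x
    simpa [hcol] using hq (σ⁻¹ x)
  · intro q hq
    simp only [Tableau.colStab, Finset.mem_filter, Finset.mem_univ, true_and, hcol] at hq ⊢
    intro x
    simpa using hq (σ x)
  · intro q _
    group
  · intro q _
    group
  · intro q _
    have hs : Perm.sign (σ * q * σ⁻¹) = Perm.sign q := by
      rw [map_mul, map_mul, Perm.sign_inv, mul_right_comm, Int.units_mul_self, one_mul]
    rw [map_smul, hs, hrow]
    congr 1
    simp only [tabloidRep, MonoidHom.coe_mk, OneHom.coe_mk, Finsupp.lmapDomain_apply,
      Finsupp.mapDomain_single]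
    congr 1
    funext x
    simp [Function.comp, mul_inv_rev]

theorem specht_invariant {n : ℕ} (lam : n.Partition) (σ : Perm (Fin n)) :
    specht lam ≤ (specht lam).comap (tabloidRep n σ) := by
  refine Submodule.span_le.2 ?_
  rintro _ ⟨T, rfl⟩
  change tabloidRep n σ (Tableau.polytabloid T) ∈ specht lam
  rw [tabloidRep_polytabloid]
  exact Submodule.subset_span ⟨_, rfl⟩

/-- The Specht module as a vector space of its own. -/
def SpechtModule {n : ℕ} (lam : n.Partition) : Type := specht lam

instance {n : ℕ} (lam : n.Partition) : AddCommGroup (SpechtModule lam) :=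
  inferInstanceAs (AddCommGroup (specht lam))

instance {n : ℕ} (lam : n.Partition) : Module ℂ (SpechtModule lam) :=
  inferInstanceAs (Module ℂ (specht lam))

/-- The irreducible representation `χ_lam` of `S_n`, realized on the Specht module. -/
def spechtRep {n : ℕ} (lam : n.Partition) :
    Representation ℂ (Perm (Fin n)) (SpechtModule lam) :=
  (tabloidRep n).subrepresentation (specht lam) (specht_invariant lam)

/-! ### Subgroups of the symmetric group -/

/-- The dihedral subgroup `D_n` of `S_n`, generated by the `n`-cycle `w_n = (1 2 … n)` and the
reflection `(1 n)(2 n-1)⋯` (with letters counted from `0`). -/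
def dihedral (n : ℕ) : Subgroup (Perm (Fin n)) :=
  Subgroup.closure {finRotate n, Fin.revPerm}

theorem zpowers_le_dihedral (n k : ℕ) :
    Subgroup.zpowers (finRotate n ^ k) ≤ dihedral n := by
  rw [Subgroup.zpowers_le]
  exact Subgroup.pow_mem _ (Subgroup.subset_closure (Set.mem_insert _ _)) k

/-- For an identification `e` of `p` disjoint blocks of `m` letters with the set of `n` letters,
the embedding `S_m^{×p} → S_n` as the corresponding Young subgroup: the `j`-th factor permutes
the `j`-th block, `(g₁, …, g_p)` sends the letter `e (j, i)` to `e (j, g_j i)`. -/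
def youngHom {n m p : ℕ} (e : Fin p × Fin m ≃ Fin n) :
    (Fin p → Perm (Fin m)) →* Perm (Fin n) :=
  (((Equiv.sigmaEquivProd (Fin p) (Fin m)).trans e).permCongrHom.toMonoidHom).comp
    (Perm.sigmaCongrRightHom fun _ : Fin p => Fin m)

theorem youngHom_apply {n m p : ℕ} (e : Fin p × Fin m ≃ Fin n) (g : Fin p → Perm (Fin m))
    (j : Fin p) (i : Fin m) : youngHom e g (e (j, i)) = e (j, g j i) := by
  simp [youngHom, Equiv.permCongrHom, Equiv.permCongr]

theorem youngHom_injective {n m p : ℕ} (e : Fin p × Fin m ≃ Fin n) :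
    Function.Injective (youngHom e) := by
  unfold youngHom
  rw [MonoidHom.coe_comp]
  exact (((Equiv.sigmaEquivProd (Fin p) (Fin m)).trans e).permCongrHom.injective).comp
    Perm.sigmaCongrRightHom_injective

/-- The blocks given by the residue classes modulo `p` in `{0, …, mp - 1}`, each in increasing
order: `(j, i) ↦ j + p * i`. These are the orbits of `w_n ^ p`, where `n = mp`. -/
def residueBlocks (m p : ℕ) : Fin p × Fin m ≃ Fin (m * p) :=
  (Equiv.prodComm (Fin p) (Fin m)).trans finProdFinEquiv

theorem val_finRotate_pow (n k : ℕ) (x : Fin n) :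
    ((finRotate n ^ k) x : ℕ) = (x + k) % n := by
  induction k with
  | zero => simp [Nat.mod_eq_of_lt x.2]
  | succ k ih =>
    have := x.neZero
    rw [pow_succ', Perm.mul_apply, finRotate_apply, Fin.val_add, ih, Fin.val_one', ← Nat.add_mod,
      add_assoc]

/-- On the residue classes modulo `p`, the permutation `w_n ^ p` acts by the `m`-cycle
`(1 2 … m)` in each of them; in particular it belongs to the Young subgroup. -/
theorem youngHom_residueBlocks (m p : ℕ) :
    youngHom (residueBlocks m p) (fun _ => finRotate m) = finRotate (m * p) ^ p := by
  ext x
  obtain ⟨⟨j, i⟩, rfl⟩ := (residueBlocks m p).surjective x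
  rw [youngHom_apply, val_finRotate_pow]
  have h := val_finRotate_pow m 1 i
  rw [pow_one] at h
  have hp : 0 < p := j.pos
  simp only [residueBlocks, Equiv.trans_apply, Equiv.prodComm_apply, Prod.swap_prod_mk,
    finProdFinEquiv_apply_val, h]
  rw [show (j : ℕ) + p * i + p = j + p * (i + 1) by ring, mul_comm m p, Nat.mod_mul,
    Nat.add_mul_mod_self_left, Nat.mod_eq_of_lt j.2, Nat.add_mul_div_left _ _ hp,
    Nat.div_eq_of_lt j.2, zero_add]

theorem zpowers_le_youngHom_range (m p : ℕ) :
    Subgroup.zpowers (finRotate (m * p) ^ p) ≤ (youngHom (residueBlocks m p)).range := by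
  rw [Subgroup.zpowers_le, ← youngHom_residueBlocks]
  exact ⟨_, rfl⟩

/-- The inclusion of `⟨w_n ^ p⟩` in `S_m^{×p}`, the latter identified with the Young subgroup of
`S_n` on the residue classes modulo `p`. -/
def cyclicToYoung (m p : ℕ) :
    Subgroup.zpowers (finRotate (m * p) ^ p) →* (Fin p → Perm (Fin m)) :=
  (MonoidHom.ofInjective (youngHom_injective (residueBlocks m p))).symm.toMonoidHom.comp
    (Subgroup.inclusion (zpowers_le_youngHom_range m p))

end DihedralRes

end

/-!
The idea is to find, inside `χ_lam`, the translates of a copy of `Ψ` under the dihedral group `D_n`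
and to show that they are independent.

By conjugation in `S_n`, a copy `U` of `Ψ` can be taken with respect to any Young subgroup `Y`. Take
the blocks to be the residue classes modulo `p`, arranged so that the partitions `μ` attached to the
classes `0, …, p - 1` increase in some total order. This arrangement leaves the restriction to
`⟨w_n ^ p⟩` unchanged, and since at least three partitions occur, no nontrivial rotation or
reflection of the cycle of classes preserves the resulting colouring (`symmetry_trivial`). The group
`D_n` normalizes `Y` and permutes the classes by rotations and reflections (`dihedral_blocks`); the
elements not in `⟨w_n ^ p⟩` therefore carry `U` to a `Y`-representation `Ψ'` whose tuple of
partitions is a different rearrangement of the same multiset.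

Irreducibility of Specht modules is not needed to separate `Ψ` from such a `Ψ'`. Let `Z_μ` be the sum
of the column antisymmetrizers `κ_T` over all tableaux `T` of shape `μ`, a central element of the
group algebra of `S_m`.
* `Z_μ` is injective on the Specht module of shape `μ` (`groupSum_spechtRep_injective`): each `κ_T` is
  positive semidefinite for the invariant Hermitian form, so a vector of the kernel is killed by all
  `κ_T`, hence orthogonal to all polytabloids.
* `Z_μ` is zero on the Specht module of shape `ν` unless `μ` dominates `ν`
  (`groupSum_spechtRep_eq_zero`), by the usual combinatorial lemma `Tableau.topCount_le`.

Hence the product `Z` of the elements `Z_{μ^i}` over the blocks is injective on `Ψ`. If it is nonzero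
on a rearrangement `Ψ'`, then each factor of `Ψ` dominates the corresponding one of `Ψ'`; comparing
the sums over all factors, the tuples are equal (`comp_eq_of_topCount_le`). So `Z` is injective on
`U` and kills its other translates. By `isContained_ind` this is enough for the translates to span a
copy of the induced representation.
-/

noncomputable section

namespace DihedralRes

open Equiv

/-! ### Group algebra elements acting on a representation -/

/-- The action of the group algebra element `∑ a(g) g` on a representation. -/
def groupSum {G V : Type*} [Group G] [Fintype G] [AddCommGroup V] [Module ℂ V]
    (ρ : Representation ℂ G V) (a : G → ℂ) : V →ₗ[ℂ] V :=
  ∑ g, a g • ρ g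

theorem groupSum_apply {G V : Type*} [Group G] [Fintype G] [AddCommGroup V] [Module ℂ V]
    (ρ : Representation ℂ G V) (a : G → ℂ) (v : V) : groupSum ρ a v = ∑ g, a g • ρ g v := by
  simp [groupSum, LinearMap.sum_apply]

/-! ### The column antisymmetrizers -/

theorem tabloidRep_single {n : ℕ} (σ : Perm (Fin n)) (f : Fin n → ℕ) (c : ℂ) :
    tabloidRep n σ (Finsupp.single f c) =
      Finsupp.single (f ∘ ((σ⁻¹ : Perm (Fin n)) : Fin n → Fin n)) c := by
  simp [tabloidRep, Finsupp.mapDomain_single]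

namespace Tableau

variable {n : ℕ} {lam mu : n.Partition}

theorem mem_colStab {T : Tableau lam} {q : Perm (Fin n)} :
    q ∈ colStab T ↔ ∀ x, col T (q x) = col T x := by
  simp [colStab]

theorem mul_mem_colStab {T : Tableau lam} {q r : Perm (Fin n)} (hq : q ∈ colStab T)
    (hr : r ∈ colStab T) : q * r ∈ colStab T := by
  rw [mem_colStab] at *
  intro x
  rw [Perm.mul_apply, hq, hr]

theorem inv_mem_colStab {T : Tableau lam} {q : Perm (Fin n)} (hq : q ∈ colStab T) :
    q⁻¹ ∈ colStab T := by
  rw [mem_colStab] at *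
  intro x
  simpa using (hq (q⁻¹ x)).symm

/-- The column antisymmetrizer `κ_T = ∑ sgn(q) q` of `T`, acting on combinations of tabloids. -/
def antisymm (T : Tableau lam) : ((Fin n → ℕ) →₀ ℂ) →ₗ[ℂ] ((Fin n → ℕ) →₀ ℂ) :=
  ∑ q ∈ colStab T, ((Perm.sign q : ℤ) : ℂ) • tabloidRep n q

theorem antisymm_apply (T : Tableau lam) (v : (Fin n → ℕ) →₀ ℂ) :
    antisymm T v = ∑ q ∈ colStab T, ((Perm.sign q : ℤ) : ℂ) • tabloidRep n q v := by
  simp [antisymm, LinearMap.sum_apply]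

theorem polytabloid_eq_antisymm (T : Tableau lam) :
    polytabloid T = antisymm T (Finsupp.single (row T) 1) := by
  simp only [polytabloid, antisymm_apply, tabloidRep_single]

theorem antisymm_antisymm (T : Tableau lam) (v : (Fin n → ℕ) →₀ ℂ) :
    antisymm T (antisymm T v) = ((colStab T).card : ℂ) • antisymm T v := by
  rw [antisymm_apply T (antisymm T v), Nat.cast_smul_eq_nsmul, ← Finset.sum_const]
  refine Finset.sum_congr rfl fun q hq => ?_
  rw [antisymm_apply, map_sum, Finset.smul_sum]
  refine Finset.sum_bij' (fun r _ => q * r) (fun r _ => q⁻¹ * r)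
    (fun r hr => mul_mem_colStab hq hr) (fun r hr => mul_mem_colStab (inv_mem_colStab hq) hr)
    (fun r _ => by simp) (fun r _ => by simp) fun r _ => ?_
  rw [map_smul, smul_smul, map_mul (tabloidRep n), Module.End.mul_apply, map_mul]
  push_cast
  rfl

/-- Two letters in one column of `T` and one row of `f` force `κ_T f = 0`. -/
theorem antisymm_single_eq_zero (T : Tableau lam) (f : Fin n → ℕ) {x y : Fin n} (hxy : x ≠ y)
    (hcol : col T x = col T y) (hf : f x = f y) : antisymm T (Finsupp.single f 1) = 0 := by
  have hs : swap x y ∈ colStab T := by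
    rw [mem_colStab]
    intro z
    rcases eq_or_ne z x with rfl | hx
    · rw [swap_apply_left, hcol]
    rcases eq_or_ne z y with rfl | hy
    · rw [swap_apply_right, hcol]
    · rw [swap_apply_of_ne_of_ne hx hy]
  rw [antisymm_apply]
  refine Finset.sum_involution (fun q _ => q * swap x y) ?_ ?_
    (fun q hq => mul_mem_colStab hq hs) ?_
  · intro q _
    have : f ∘ ((q * swap x y)⁻¹ : Perm (Fin n)) = f ∘ (q⁻¹ : Perm (Fin n)) := by
      funext z
      simp only [mul_inv_rev, swap_inv, Function.comp_apply, Perm.mul_apply]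
      rcases eq_or_ne (q⁻¹ z) x with hx | hx
      · rw [hx, swap_apply_left, hf]
      rcases eq_or_ne (q⁻¹ z) y with hy | hy
      · rw [hy, swap_apply_right, hf]
      · rw [swap_apply_of_ne_of_ne hx hy]
    rw [tabloidRep_single, tabloidRep_single, this, Perm.sign_mul, Perm.sign_swap hxy]
    simp
  · intro q _ _ h
    exact hxy (swap_eq_one_iff.1 (mul_eq_left.1 h))
  · intro q _
    simp [mul_assoc]

end Tableau

/-! ### Dominance order -/

/-- The number of cells in the first `k` rows of the diagram of `lam`. One partition dominates
another iff all these numbers are at least as large. -/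
def topCount {n : ℕ} (lam : n.Partition) (k : ℕ) : ℕ :=
  ((diagram lam).cells.filter fun c => c.1 < k).card

theorem topCount_succ {n : ℕ} (lam : n.Partition) (k : ℕ) :
    topCount lam (k + 1) = topCount lam k + (diagram lam).rowLen k := by
  rw [YoungDiagram.rowLen_eq_card, topCount, topCount, YoungDiagram.row,
    ← Finset.card_union_of_disjoint]
  · congr 1
    ext c
    simp only [Finset.mem_filter, Finset.mem_union, YoungDiagram.mem_cells]
    constructor
    · rintro ⟨h, h'⟩
      rcases Nat.lt_succ_iff_lt_or_eq.1 h' with h1 | h1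
      · exact Or.inl ⟨h, h1⟩
      · exact Or.inr ⟨h, h1⟩
    · rintro (⟨h, h'⟩ | ⟨h, h'⟩)
      · exact ⟨h, by omega⟩
      · exact ⟨h, by omega⟩
  · rw [Finset.disjoint_left]
    intro c hc hc'
    simp only [Finset.mem_filter] at hc hc'
    omega

theorem diagram_injective {n : ℕ} : Function.Injective (diagram (n := n)) := by
  intro lam mu h
  have key : ∀ nu : n.Partition, (diagram nu).rowLens = nu.parts.sort (· ≥ ·) := fun nu =>
    YoungDiagram.rowLens_ofRowLens_eq_self fun x hx =>
      nu.parts_pos ((Multiset.mem_sort _).1 hx)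
  have h2 : lam.parts.sort (· ≥ ·) = mu.parts.sort (· ≥ ·) := by
    rw [← key, ← key, h]
  ext1
  rw [← Multiset.sort_eq lam.parts (· ≥ ·), h2, Multiset.sort_eq]

/-- Dominance is antisymmetric. -/
theorem topCount_injective {n : ℕ} : Function.Injective (topCount (n := n)) := by
  intro lam mu h
  apply diagram_injective
  have hrow : ∀ k, (diagram lam).rowLen k = (diagram mu).rowLen k := by
    intro k
    have h1 := topCount_succ lam k
    have h2 := topCount_succ mu k
    rw [h] at h1
    omega
  ext ⟨i, j⟩
  rw [YoungDiagram.mem_cells, YoungDiagram.mem_cells, YoungDiagram.mem_iff_lt_rowLen,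
    YoungDiagram.mem_iff_lt_rowLen, hrow]

namespace Tableau

variable {n : ℕ} {lam mu : n.Partition}

theorem card_row_lt (T : Tableau lam) (k : ℕ) :
    (Finset.univ.filter fun x => row T x < k).card = topCount lam k := by
  refine Finset.card_bij (fun x _ => (T.symm x).1) ?_ ?_ ?_
  · intro x hx
    simp only [Finset.mem_filter, Finset.mem_univ, true_and] at hx
    exact Finset.mem_filter.2 ⟨(T.symm x).2, hx⟩
  · intro x _ y _ h
    exact T.symm.injective (Subtype.ext h)
  · intro c hc
    rw [Finset.mem_filter] at hc
    exact ⟨T ⟨c, hc.1⟩, Finset.mem_filter.2 ⟨Finset.mem_univ _, by simpa [row] using hc.2⟩, by simp⟩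

/-- The basic combinatorial lemma: if letters sharing a column of `T` lie in distinct rows of `S`,
then the shape of `T` dominates that of `S`. Column by column, the first `k` rows of `S` contain at
most as many letters as the first `k` rows of `T`. -/
theorem topCount_le (T : Tableau mu) (S : Tableau lam)
    (h : ∀ x y, x ≠ y → col T x = col T y → row S x ≠ row S y) (k : ℕ) :
    topCount lam k ≤ topCount mu k := by
  classical
  rw [← card_row_lt S, ← card_row_lt T,
    Finset.card_eq_sum_card_fiberwise (f := col T) (t := Finset.univ.image (col T))
      (fun x _ => by simp),
    Finset.card_eq_sum_card_fiberwise (f := col T) (t := Finset.univ.image (col T))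
      (s := Finset.univ.filter fun x => row T x < k) (fun x _ => by simp)]
  refine Finset.sum_le_sum fun j _ => ?_
  by_cases hj : ∀ x, col T x = j → row T x < k
  · refine Finset.card_le_card fun x hx => ?_
    simp only [Finset.mem_filter, Finset.mem_univ, true_and] at hx ⊢
    exact ⟨hj x hx.2, hx.2⟩
  · push Not at hj
    obtain ⟨x, hx, hk⟩ := hj
    have hmem : ∀ r < k, (r, j) ∈ (diagram mu).cells := by
      intro r hr
      have h1 : (row T x, j) ∈ diagram mu := by
        rw [← hx]
        exact (T.symm x).2
      exact (diagram mu).up_left_mem (le_of_lt (hr.trans_le hk)) le_rfl h1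
    calc _ ≤ (Finset.range k).card := by
            refine Finset.card_le_card_of_injOn (row S) ?_ ?_
            · intro y hy
              simp only [Finset.coe_filter, Finset.mem_filter, Finset.mem_univ, true_and,
                Set.mem_ofPred_eq] at hy
              simpa using hy.1
            · intro y hy z hz hyz
              simp only [Finset.coe_filter, Finset.mem_filter, Finset.mem_univ, true_and,
                Set.mem_ofPred_eq] at hy hz
              by_contra hne
              exact h y z hne (hy.2.trans hz.2.symm) hyz
      _ ≤ _ := by
            refine Finset.card_le_card_of_surjOn (row T) ?_
            intro r hr
            have hr' : r < k := by simpa using hr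
            exact ⟨T ⟨(r, j), hmem r hr'⟩, Finset.mem_coe.2 (Finset.mem_filter.2
              ⟨Finset.mem_filter.2 ⟨Finset.mem_univ _, by simpa [row] using hr'⟩, by simp [col]⟩),
              by simp [row]⟩

/-- The antisymmetrizer of a tableau annihilates every Specht module whose shape is not dominated
by the shape of the tableau. -/
theorem antisymm_eq_zero (T : Tableau mu) (h : ¬ ∀ k, topCount lam k ≤ topCount mu k)
    {v : (Fin n → ℕ) →₀ ℂ} (hv : v ∈ specht lam) : antisymm T v = 0 := by
  have hrow : ∀ S : Tableau lam, antisymm T (Finsupp.single (row S) 1) = 0 := by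
    intro S
    by_contra hne
    refine h (topCount_le T S fun x y hxy hc hr => hne ?_)
    exact antisymm_single_eq_zero T _ hxy hc hr
  suffices specht lam ≤ LinearMap.ker (antisymm T) from this hv
  refine Submodule.span_le.2 ?_
  rintro _ ⟨S, rfl⟩
  rw [SetLike.mem_coe, LinearMap.mem_ker, polytabloid, map_sum]
  refine Finset.sum_eq_zero fun q _ => ?_
  rw [map_smul]
  exact (congrArg _ (hrow (S.trans q))).trans (smul_zero _)

end Tableau

/-! ### The invariant Hermitian form on tabloids -/

/-- The standard Hermitian form on formal combinations of functions `[n] → ℕ`, linear in the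
second variable. -/
def tabloidForm {n : ℕ} (u : (Fin n → ℕ) →₀ ℂ) : ((Fin n → ℕ) →₀ ℂ) →ₗ[ℂ] ℂ :=
  Finsupp.linearCombination ℂ fun f => star (u f)

theorem tabloidForm_single {n : ℕ} (u : (Fin n → ℕ) →₀ ℂ) (f : Fin n → ℕ) :
    tabloidForm u (Finsupp.single f 1) = star (u f) := by
  simp [tabloidForm]

theorem tabloidForm_self {n : ℕ} (u : (Fin n → ℕ) →₀ ℂ) :
    tabloidForm u u = ((u.sum fun _ c => ‖c‖ ^ 2 : ℝ) : ℂ) := by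
  rw [tabloidForm, Finsupp.linearCombination_apply, Finsupp.sum, Finsupp.sum, Complex.ofReal_sum]
  refine Finset.sum_congr rfl fun f _ => ?_
  rw [smul_eq_mul, Complex.star_def, Complex.mul_conj, Complex.normSq_eq_norm_sq]

theorem tabloidForm_self_re_nonneg {n : ℕ} (u : (Fin n → ℕ) →₀ ℂ) : 0 ≤ (tabloidForm u u).re := by
  rw [tabloidForm_self, Complex.ofReal_re]
  exact Finset.sum_nonneg fun _ _ => by positivity

theorem eq_zero_of_tabloidForm_self_re {n : ℕ} {u : (Fin n → ℕ) →₀ ℂ}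
    (h : (tabloidForm u u).re = 0) : u = 0 := by
  rw [tabloidForm_self, Complex.ofReal_re, Finsupp.sum,
    Finset.sum_eq_zero_iff_of_nonneg fun _ _ => by positivity] at h
  ext f
  by_cases hf : f ∈ u.support
  · simpa using h f hf
  · simpa using hf

theorem tabloidForm_tabloidRep {n : ℕ} (σ : Perm (Fin n)) (u v : (Fin n → ℕ) →₀ ℂ) :
    tabloidForm (tabloidRep n σ u) v = tabloidForm u (tabloidRep n σ⁻¹ v) := by
  suffices tabloidForm (tabloidRep n σ u) = tabloidForm u ∘ₗ tabloidRep n σ⁻¹ from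
    LinearMap.congr_fun this v
  ext f
  have hinj : Function.Injective
      fun f : Fin n → ℕ => f ∘ ((σ⁻¹ : Perm (Fin n)) : Fin n → Fin n) :=
    σ⁻¹.surjective.injective_comp_right
  have h := Finsupp.mapDomain_apply hinj u (f ∘ σ)
  simp only [LinearMap.coe_comp, Function.comp_apply, Finsupp.lsingle_apply, tabloidForm_single,
    tabloidRep_single, inv_inv]
  congr 1
  rw [← h]
  change Finsupp.mapDomain _ u f = _
  congr 1
  funext x
  simp

theorem tabloidForm_antisymm {n : ℕ} {lam : n.Partition} (T : Tableau lam)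
    (u v : (Fin n → ℕ) →₀ ℂ) :
    tabloidForm (T.antisymm u) v = tabloidForm u (T.antisymm v) := by
  have hadd : ∀ (s : Finset (Perm (Fin n))) (c : Perm (Fin n) → ℤ),
      tabloidForm (∑ q ∈ s, (c q : ℂ) • tabloidRep n q u) v =
        ∑ q ∈ s, (c q : ℂ) * tabloidForm (tabloidRep n q u) v := by
    intro s c
    suffices tabloidForm (∑ q ∈ s, (c q : ℂ) • tabloidRep n q u) =
        ∑ q ∈ s, (c q : ℂ) • tabloidForm (tabloidRep n q u) by
      rw [this, LinearMap.sum_apply]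
      rfl
    ext f
    simp [tabloidForm_single, Finsupp.finsetSum_apply]
  rw [Tableau.antisymm_apply, Tableau.antisymm_apply, map_sum, hadd]
  refine Finset.sum_bij' (fun r _ => r⁻¹) (fun r _ => r⁻¹)
    (fun r hr => Tableau.inv_mem_colStab hr) (fun r hr => Tableau.inv_mem_colStab hr)
    (fun r _ => by simp) (fun r _ => by simp) fun r _ => ?_
  rw [tabloidForm_tabloidRep, map_smul, smul_eq_mul, Perm.sign_inv]

/-! ### Separating Specht modules -/

/-- The coefficients of the sum `∑ κ_T` over all tableaux of shape `lam`, an element of the group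
algebra of `S_n`. -/
def antisymmCoeff {n : ℕ} (lam : n.Partition) (g : Perm (Fin n)) : ℂ :=
  ∑ T : Tableau lam, if g ∈ T.colStab then ((Perm.sign g : ℤ) : ℂ) else 0

/-- `∑ κ_T` is central. -/
theorem antisymmCoeff_conj {n : ℕ} (lam : n.Partition) (c g : Perm (Fin n)) :
    antisymmCoeff lam (c⁻¹ * g * c) = antisymmCoeff lam g := by
  refine Fintype.sum_equiv (Equiv.equivCongr (Equiv.refl _) c) _ _ fun T => ?_
  have hs : Perm.sign (c⁻¹ * g * c) = Perm.sign g := by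
    rw [map_mul, map_mul, Perm.sign_inv, mul_right_comm, Int.units_mul_self, one_mul]
  have hcol : ∀ x, Tableau.col (lam := lam) (T.trans c) x = Tableau.col T (c⁻¹ x) := fun _ => rfl
  rw [hs]
  refine if_congr ?_ rfl rfl
  change _ ↔ g ∈ Tableau.colStab (lam := lam) (T.trans c)
  rw [Tableau.mem_colStab, Tableau.mem_colStab]
  refine ⟨fun h x => ?_, fun h x => ?_⟩
  · simpa [hcol] using h (c⁻¹ x)
  · simpa [hcol] using h (c x)

theorem groupSum_antisymmCoeff {n : ℕ} (lam : n.Partition) (v : (Fin n → ℕ) →₀ ℂ) :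
    groupSum (tabloidRep n) (antisymmCoeff lam) v = ∑ T : Tableau lam, T.antisymm v := by
  simp only [groupSum_apply, antisymmCoeff, Finset.sum_smul, Tableau.antisymm_apply]
  rw [Finset.sum_comm]
  refine Finset.sum_congr rfl fun T _ => ?_
  simp only [ite_smul, zero_smul, Finset.sum_ite_mem, Finset.univ_inter]

/-- The inclusion of the Specht module into the combinations of tabloids. -/
def SpechtModule.incl {n : ℕ} (lam : n.Partition) :
    SpechtModule lam →ₗ[ℂ] ((Fin n → ℕ) →₀ ℂ) :=
  (specht lam).subtype

theorem SpechtModule.incl_injective {n : ℕ} (lam : n.Partition) :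
    Function.Injective (SpechtModule.incl lam) :=
  (specht lam).injective_subtype

theorem SpechtModule.incl_mem {n : ℕ} {lam : n.Partition} (v : SpechtModule lam) :
    SpechtModule.incl lam v ∈ specht lam :=
  Subtype.prop (p := (· ∈ specht lam)) v

theorem SpechtModule.incl_groupSum {n : ℕ} {lam : n.Partition} (a : Perm (Fin n) → ℂ)
    (v : SpechtModule lam) :
    SpechtModule.incl lam (groupSum (spechtRep lam) a v) =
      groupSum (tabloidRep n) a (SpechtModule.incl lam v) := by
  rw [groupSum_apply, groupSum_apply, map_sum]
  refine Finset.sum_congr rfl fun g _ => ?_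
  rw [map_smul]
  rfl

/-- `∑ κ_T` over the tableaux of shape `mu` annihilates the Specht modules of shapes that `mu` does
not dominate. -/
theorem groupSum_spechtRep_eq_zero {n : ℕ} {lam mu : n.Partition}
    (h : ¬ ∀ k, topCount lam k ≤ topCount mu k) :
    groupSum (spechtRep lam) (antisymmCoeff mu) = 0 := by
  ext v
  apply SpechtModule.incl_injective
  rw [SpechtModule.incl_groupSum, groupSum_antisymmCoeff, LinearMap.zero_apply, map_zero]
  exact Finset.sum_eq_zero fun T _ => T.antisymm_eq_zero h (SpechtModule.incl_mem v)

/-- `∑ κ_T` over the tableaux of shape `lam` acts injectively on the Specht module of shape `lam`: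
every `κ_T` is positive semidefinite, being a positive multiple of an orthogonal projection, so a
vector `v` in the kernel satisfies `κ_T v = 0` for all `T`; then `v` is orthogonal to every
polytabloid. -/
theorem groupSum_spechtRep_injective {n : ℕ} (lam : n.Partition) :
    Function.Injective (groupSum (spechtRep lam) (antisymmCoeff lam)) := by
  rw [injective_iff_map_eq_zero]
  intro x hx
  apply SpechtModule.incl_injective
  rw [map_zero]
  set v := SpechtModule.incl lam x with hv
  have hsum : ∑ T : Tableau lam, T.antisymm v = 0 := by
    rw [← groupSum_antisymmCoeff, hv, ← SpechtModule.incl_groupSum, hx, map_zero]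
  have hself : ∀ T : Tableau lam, ((T.colStab.card : ℝ) * (tabloidForm v (T.antisymm v)).re) =
      (tabloidForm (T.antisymm v) (T.antisymm v)).re := by
    intro T
    rw [tabloidForm_antisymm, Tableau.antisymm_antisymm, map_smul, smul_eq_mul,
      ← Complex.ofReal_natCast, Complex.re_ofReal_mul]
  have hpos : ∀ T : Tableau lam, 0 < (T.colStab.card : ℝ) := by
    intro T
    rw [Nat.cast_pos, Finset.card_pos]
    exact ⟨1, Tableau.mem_colStab.2 fun _ => rfl⟩
  have hnonneg : ∀ T : Tableau lam, 0 ≤ (tabloidForm v (T.antisymm v)).re := by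
    intro T
    refine nonneg_of_mul_nonneg_right ?_ (hpos T)
    rw [hself]
    exact tabloidForm_self_re_nonneg _
  have hzero : ∀ T : Tableau lam, (tabloidForm v (T.antisymm v)).re = 0 := by
    have h0 : ∑ T : Tableau lam, (tabloidForm v (T.antisymm v)).re = 0 := by
      rw [← Complex.re_sum, ← map_sum, hsum, map_zero, Complex.zero_re]
    intro T
    exact (Finset.sum_eq_zero_iff_of_nonneg fun T _ => hnonneg T).1 h0 T (Finset.mem_univ T)
  have hanti : ∀ T : Tableau lam, T.antisymm v = 0 := by
    intro T
    apply eq_zero_of_tabloidForm_self_re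
    rw [← hself, hzero, mul_zero]
  have hker : specht lam ≤ LinearMap.ker (tabloidForm v) := by
    refine Submodule.span_le.2 ?_
    rintro _ ⟨T, rfl⟩
    rw [SetLike.mem_coe, LinearMap.mem_ker, Tableau.polytabloid_eq_antisymm,
      ← tabloidForm_antisymm, hanti]
    simp [tabloidForm]
  apply eq_zero_of_tabloidForm_self_re
  rw [LinearMap.mem_ker.1 (hker (SpechtModule.incl_mem x)), Complex.zero_re]

/-! ### Outer tensor products -/

theorem groupSum_outerTensor {ι : Type*} [Fintype ι] [DecidableEq ι] {G V : ι → Type*}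
    [∀ i, Group (G i)] [∀ i, Fintype (G i)] [∀ i, AddCommGroup (V i)] [∀ i, Module ℂ (V i)]
    (ρ : ∀ i, Representation ℂ (G i) (V i)) (a : ∀ i, G i → ℂ) :
    groupSum (outerTensor ρ) (fun g => ∏ i, a i (g i)) =
      PiTensorProduct.map fun i => groupSum (ρ i) (a i) := by
  have h := (PiTensorProduct.mapMultilinear ℂ V V).map_sum fun i (g : G i) => a i g • ρ i g
  rw [PiTensorProduct.mapMultilinear_apply] at h
  refine Eq.trans ?_ h.symm
  refine Finset.sum_congr rfl fun g _ => ?_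
  rw [MultilinearMap.map_smul_univ]
  rfl

theorem piTensorProduct_map_injective {ι : Type*} {V W : ι → Type*}
    [∀ i, AddCommGroup (V i)] [∀ i, Module ℂ (V i)] [∀ i, AddCommGroup (W i)]
    [∀ i, Module ℂ (W i)] (f : ∀ i, V i →ₗ[ℂ] W i) (hf : ∀ i, Function.Injective (f i)) :
    Function.Injective (PiTensorProduct.map f) := by
  choose g hg using fun i =>
    LinearMap.exists_leftInverse_of_injective (f i) (LinearMap.ker_eq_bot.2 (hf i))
  refine Function.LeftInverse.injective (g := PiTensorProduct.map g) fun x => ?_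
  rw [← LinearMap.comp_apply, ← PiTensorProduct.map_comp]
  simp only [hg, PiTensorProduct.map_id, LinearMap.id_apply]

theorem piTensorProduct_map_eq_zero {ι : Type*} {V W : ι → Type*}
    [∀ i, AddCommGroup (V i)] [∀ i, Module ℂ (V i)] [∀ i, AddCommGroup (W i)]
    [∀ i, Module ℂ (W i)] (f : ∀ i, V i →ₗ[ℂ] W i) {i : ι} (hi : f i = 0) :
    PiTensorProduct.map f = 0 := by
  ext x
  simp only [LinearMap.compMultilinearMap_apply, PiTensorProduct.map_tprod, LinearMap.zero_apply]
  exact MultilinearMap.map_coord_zero _ i (by rw [hi, LinearMap.zero_apply])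

/-! ### Subrepresentations isomorphic to induced ones -/

section Induction

open scoped MonoidAlgebra

variable {H G A B : Type*} [Group H] [Group G] [AddCommGroup A] [Module ℂ A]
  [AddCommGroup B] [Module ℂ B] (φ : H →* G) {ρ : Representation ℂ H A}
  {τ : Representation ℂ G B}

/-- Frobenius reciprocity: an `H`-equivariant map `f` into a representation of `G` induces a map
from the induced representation, sending `⟦g ⊗ a⟧` to `g⁻¹ f(a)`. -/
def indLift (f : A →ₗ[ℂ] B) (hf : ∀ h a, f (ρ h a) = τ (φ h) (f a)) :
    Representation.IndV φ ρ →ₗ[ℂ] B :=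
  Representation.Coinvariants.lift _
    (TensorProduct.lift <| (Finsupp.lift _ _ _ fun g => τ g⁻¹ ∘ₗ f) ∘ₗ
      (MonoidAlgebra.coeffLinearEquiv ℂ).toLinearMap)
    fun h => by
      ext g x
      simp only [LinearMap.coe_comp, Function.comp_apply, MonoidAlgebra.lsingle_apply]
      simp [mul_inv_rev, hf]

theorem indLift_mk (f : A →ₗ[ℂ] B) (hf : ∀ h a, f (ρ h a) = τ (φ h) (f a)) (g : G) (a : A) :
    indLift φ f hf (Representation.IndV.mk φ ρ g a) = τ g⁻¹ (f a) := by
  simp [indLift]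

theorem indV_mk_mul (h : H) (g : G) (a : A) :
    Representation.IndV.mk φ ρ (φ h * g) (ρ h a) = Representation.IndV.mk φ ρ g a := by
  have := Representation.Coinvariants.mk_self_apply
    (Representation.tprod ((Representation.leftRegular ℂ G).comp φ) ρ) h
    (TensorProduct.tmul ℂ (MonoidAlgebra.single g 1) a)
  simpa using this

theorem exists_sum_indV_mk [Fintype G] (v : Representation.IndV φ ρ) :
    ∃ x : G → A, v = ∑ g, Representation.IndV.mk φ ρ g (x g) := by
  classical
  suffices (⊤ : Submodule ℂ (Representation.IndV φ ρ)) ≤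
      LinearMap.range (∑ g, Representation.IndV.mk φ ρ g ∘ₗ LinearMap.proj (φ := fun _ => A) g) by
    obtain ⟨x, hx⟩ := this (Submodule.mem_top (x := v))
    exact ⟨x, by simpa [LinearMap.sum_apply] using hx.symm⟩
  intro v _
  induction v using Representation.Coinvariants.induction_on with | h t => ?_
  induction t using TensorProduct.induction_on with
  | zero => rw [map_zero]; exact Submodule.zero_mem _
  | add s t hs ht =>
    rw [map_add]
    exact Submodule.add_mem _ (hs Submodule.mem_top) (ht Submodule.mem_top)
  | tmul r a =>
    induction r using MonoidAlgebra.induction_linear with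
    | zero => rw [TensorProduct.zero_tmul, map_zero]; exact Submodule.zero_mem _
    | add r s hr hs =>
      rw [TensorProduct.add_tmul, map_add]
      exact Submodule.add_mem _ (hr Submodule.mem_top) (hs Submodule.mem_top)
    | single g c =>
      refine ⟨Pi.single g (c • a), ?_⟩
      rw [LinearMap.sum_apply, Finset.sum_eq_single g]
      · simp only [LinearMap.coe_comp, Function.comp_apply, LinearMap.proj_apply, Pi.single_eq_same,
          map_smul, TensorProduct.mk_apply]
        rw [← map_smul, TensorProduct.smul_tmul', MonoidAlgebra.smul_single, smul_eq_mul, mul_one]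
      · intro k _ hk
        simp [Pi.single_eq_of_ne hk]
      · simp

/-- If an operator `P` is injective on the image of an `H`-equivariant map `f` and annihilates all
its translates by elements outside of `H`, then these translates, one for each coset of `H`, are
independent and span a copy of the induced representation. -/
theorem isContained_ind [Finite G] (hφ : Function.Injective φ) (f : A →ₗ[ℂ] B)
    (hf : ∀ h a, f (ρ h a) = τ (φ h) (f a)) (P : B →ₗ[ℂ] B) (hP : ∀ a, P (f a) = 0 → a = 0)
    (hP' : ∀ g ∉ φ.range, ∀ a, P (τ g (f a)) = 0) :
    IsContained (Representation.ind φ ρ) τ := by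
  classical
  have := Fintype.ofFinite G
  have := Fintype.ofInjective φ hφ
  refine ⟨⟨indLift φ f hf, fun g => ?_⟩, ?_⟩
  · refine Representation.IndV.hom_ext φ ρ fun k => LinearMap.ext fun a => ?_
    simp only [LinearMap.comp_apply]
    have h1 := Representation.ind_mk φ ρ g k a
    simp only [LinearMap.comp_apply] at h1
    rw [h1]
    have h2 := indLift_mk φ f hf (k * g⁻¹) a
    have h3 := indLift_mk φ f hf k a
    simp only [LinearMap.comp_apply] at h2 h3
    rw [h2, h3, mul_inv_rev, inv_inv, map_mul, Module.End.mul_apply]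
  · change Function.Injective (indLift φ f hf)
    rw [injective_iff_map_eq_zero]
    intro v hv
    obtain ⟨x, rfl⟩ := exists_sum_indV_mk φ v
    rw [map_sum] at hv
    simp only [indLift_mk] at hv
    -- The total contribution of each coset vanishes.
    have hcoset : ∀ g, ∑ h, ρ h (x ((φ h)⁻¹ * g)) = 0 := by
      intro g
      apply hP
      have h1 : ∑ k, P (τ (g * k⁻¹) (f (x k))) = 0 := by
        have := congrArg (fun b => P (τ g b)) hv
        simpa [map_sum] using this
      rw [← h1, map_sum, map_sum]
      refine Fintype.sum_of_injective (fun h => (φ h)⁻¹ * g) ?_ _ _ ?_ ?_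
      · intro h k hk
        exact hφ (inv_injective (mul_right_cancel hk))
      · intro k hk
        refine hP' _ ?_ _
        rintro ⟨h, hh⟩
        exact hk ⟨h, by simp [hh]⟩
      · intro h
        simp [hf]
    have hcard : (Fintype.card H : ℂ) • ∑ g, Representation.IndV.mk φ ρ g (x g) = 0 := by
      have h1 : ∑ g, Representation.IndV.mk φ ρ g (∑ h, ρ h (x ((φ h)⁻¹ * g))) = 0 :=
        Finset.sum_eq_zero fun g _ => by rw [hcoset, map_zero]
      rw [← h1]
      simp only [map_sum]
      rw [Finset.sum_comm, Nat.cast_smul_eq_nsmul, Fintype.card, ← Finset.sum_const]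
      refine Finset.sum_congr rfl fun h _ => ?_
      refine Fintype.sum_equiv (Equiv.mulLeft (φ h)) _ _ fun g => ?_
      rw [Equiv.coe_mulLeft, indV_mk_mul, inv_mul_cancel_left]
    exact (smul_eq_zero.1 hcard).resolve_left (Nat.cast_ne_zero.2 Fintype.card_ne_zero)

end Induction

/-! ### The action of the dihedral group on the residue classes -/

/-- Elements of the dihedral group act as `x ↦ x + k` or `x ↦ k - x` modulo `n`. -/
theorem dihedral_apply {n : ℕ} [NeZero n] {d : Perm (Fin n)} (hd : d ∈ dihedral n) :
    (∃ k : ZMod n, ∀ x : Fin n, ((d x : ℕ) : ZMod n) = (x : ℕ) + k) ∨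
      ∃ k : ZMod n, ∀ x : Fin n, ((d x : ℕ) : ZMod n) = k - (x : ℕ) := by
  induction hd using Subgroup.closure_induction with
  | mem d hd =>
    rcases hd with rfl | rfl
    · refine Or.inl ⟨1, fun x => ?_⟩
      have h := val_finRotate_pow n 1 x
      rw [pow_one] at h
      rw [h, ZMod.natCast_mod]
      push_cast
      rfl
    · refine Or.inr ⟨-1, fun x => ?_⟩
      rw [Fin.revPerm_apply, Fin.val_rev, Nat.cast_sub (by omega), ZMod.natCast_self]
      push_cast
      ring
  | one => exact Or.inl ⟨0, fun x => by simp⟩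
  | mul d d' _ _ h h' =>
    rcases h with ⟨k, hk⟩ | ⟨k, hk⟩ <;> rcases h' with ⟨l, hl⟩ | ⟨l, hl⟩
    · exact Or.inl ⟨l + k, fun x => by rw [Perm.mul_apply, hk, hl, add_assoc]⟩
    · exact Or.inr ⟨l + k, fun x => by rw [Perm.mul_apply, hk, hl]; ring⟩
    · exact Or.inr ⟨k - l, fun x => by rw [Perm.mul_apply, hk, hl]; ring⟩
    · exact Or.inl ⟨k - l, fun x => by rw [Perm.mul_apply, hk, hl]; ring⟩
  | inv d _ h =>
    rcases h with ⟨k, hk⟩ | ⟨k, hk⟩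
    · refine Or.inl ⟨-k, fun x => ?_⟩
      have := hk (d⁻¹ x)
      rw [show d (d⁻¹ x) = x from d.apply_symm_apply x] at this
      rw [this]
      ring
    · refine Or.inr ⟨k, fun x => ?_⟩
      have := hk (d⁻¹ x)
      rw [show d (d⁻¹ x) = x from d.apply_symm_apply x] at this
      rw [this]
      ring

theorem residueBlocks_cast (m p : ℕ) (r : Fin p) (i : Fin m) :
    ((residueBlocks m p (r, i) : ℕ) : ZMod p) = (r : ℕ) := by
  simp [residueBlocks]

theorem fin_ext_of_cast {p : ℕ} {r s : Fin p} (h : ((r : ℕ) : ZMod p) = (s : ℕ)) : r = s := by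
  rw [ZMod.natCast_eq_natCast_iff', Nat.mod_eq_of_lt r.2, Nat.mod_eq_of_lt s.2] at h
  exact Fin.ext h

/-- The block containing a letter is determined by the residue of the letter. -/
theorem residueBlocks_symm_cast (m p : ℕ) (x : Fin (m * p)) :
    ((((residueBlocks m p).symm x).1 : ℕ) : ZMod p) = (x : ℕ) := by
  obtain ⟨⟨r, i⟩, rfl⟩ := (residueBlocks m p).surjective x
  rw [symm_apply_apply, residueBlocks_cast]

/-- A permutation that maps blocks into blocks permutes the blocks, and is given by bijections
between them. -/
theorem exists_block_perm {κ ι X : Type*} [Finite κ] [Finite ι] [Nonempty ι] (e : κ × ι ≃ X)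
    (d : Perm X) (h : ∀ r i i', (e.symm (d (e (r, i)))).1 = (e.symm (d (e (r, i')))).1) :
    ∃ (δ : Perm κ) (c : κ → Perm ι), ∀ r i, d (e (r, i)) = e (δ r, c r i) := by
  obtain ⟨i₀⟩ := ‹Nonempty ι›
  have hδ : Function.Bijective fun r => (e.symm (d (e (r, i₀)))).1 := by
    rw [← Finite.surjective_iff_bijective]
    intro s
    obtain ⟨⟨r, i⟩, hri⟩ := e.surjective (d.symm (e (s, i₀)))
    refine ⟨r, ?_⟩
    change (e.symm (d (e (r, i₀)))).1 = s
    rw [h r i₀ i, hri, apply_symm_apply, symm_apply_apply]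
  have hc : ∀ r, Function.Bijective fun i => (e.symm (d (e (r, i)))).2 := by
    intro r
    rw [← Finite.injective_iff_bijective]
    intro i i' hi
    have h1 : e.symm (d (e (r, i))) = e.symm (d (e (r, i'))) := Prod.ext (h r i i') hi
    exact (Prod.ext_iff.1 (e.injective (d.injective (e.symm.injective h1)))).2
  refine ⟨Equiv.ofBijective _ hδ, fun r => Equiv.ofBijective _ (hc r), fun r i => ?_⟩
  rw [← symm_apply_eq]
  exact Prod.ext (h r i i₀) rfl

/-- An element of the dihedral group permutes the residue classes modulo `p`, by a rotation or a
reflection; if it fixes all of them as a rotation, it is a power of `w_n ^ p`. -/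
theorem dihedral_blocks {m p : ℕ} [NeZero m] [NeZero p] {d : Perm (Fin (m * p))}
    (hd : d ∈ dihedral (m * p)) :
    ∃ (δ : Perm (Fin p)) (c : Fin p → Perm (Fin m)),
      (∀ r i, d (residueBlocks m p (r, i)) = residueBlocks m p (δ r, c r i)) ∧
      ((∃ k : ZMod p, (∀ r : Fin p, ((δ r : ℕ) : ZMod p) = (r : ℕ) + k) ∧
          (k = 0 → d ∈ Subgroup.zpowers (finRotate (m * p) ^ p))) ∨
        ∃ k : ZMod p, ∀ r : Fin p, ((δ r : ℕ) : ZMod p) = k - (r : ℕ)) := by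
  have hdvd : p ∣ m * p := dvd_mul_left p m
  have key : (∃ k : ZMod p, (∀ x : Fin (m * p), ((d x : ℕ) : ZMod p) = (x : ℕ) + k) ∧
        (k = 0 → d ∈ Subgroup.zpowers (finRotate (m * p) ^ p))) ∨
      ∃ k : ZMod p, ∀ x : Fin (m * p), ((d x : ℕ) : ZMod p) = k - (x : ℕ) := by
    rcases dihedral_apply hd with ⟨k, hk⟩ | ⟨k, hk⟩
    · refine Or.inl ⟨ZMod.castHom hdvd (ZMod p) k, fun x => ?_, fun h0 => ?_⟩
      · simpa using congrArg (ZMod.castHom hdvd (ZMod p)) (hk x)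
      · have hdk : d = finRotate (m * p) ^ k.val := by
          ext x
          have h1 := hk x
          rw [← ZMod.natCast_zmod_val k, ← Nat.cast_add, ZMod.natCast_eq_natCast_iff',
            Nat.mod_eq_of_lt (d x).2] at h1
          rw [h1, val_finRotate_pow]
        rw [← ZMod.natCast_zmod_val k, map_natCast, ZMod.natCast_eq_zero_iff] at h0
        obtain ⟨l, hl⟩ := h0
        rw [hdk, hl, pow_mul]
        exact Subgroup.npow_mem_zpowers _ l
    · refine Or.inr ⟨ZMod.castHom hdvd (ZMod p) k, fun x => ?_⟩
      simpa using congrArg (ZMod.castHom hdvd (ZMod p)) (hk x)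
  obtain ⟨δ, c, hδ⟩ := exists_block_perm (residueBlocks m p) d fun r i i' => by
    apply fin_ext_of_cast
    rw [residueBlocks_symm_cast, residueBlocks_symm_cast]
    rcases key with ⟨k, hk, -⟩ | ⟨k, hk⟩ <;>
      rw [hk, hk, residueBlocks_cast, residueBlocks_cast]
  have i₀ : Fin m := 0
  refine ⟨δ, c, hδ, key.imp ?_ ?_⟩
  · rintro ⟨k, hk, h0⟩
    refine ⟨k, fun r => ?_, h0⟩
    rw [← residueBlocks_cast m p r i₀, ← hk, hδ, residueBlocks_cast]
  · rintro ⟨k, hk⟩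
    refine ⟨k, fun r => ?_⟩
    rw [← residueBlocks_cast m p r i₀, ← hk, hδ, residueBlocks_cast]

/-! ### Colourings of a regular polygon without symmetries -/

theorem cast_eq_add_one {p a b : ℕ} (ha : a < p) (hb : b < p) (h : (b : ZMod p) = a + 1) :
    b = a + 1 ∨ b = 0 := by
  rw [← Nat.cast_succ, ZMod.natCast_eq_natCast_iff', Nat.mod_eq_of_lt hb] at h
  rcases eq_or_lt_of_le (Nat.succ_le_of_lt ha) with h1 | h1
  · rw [h1, Nat.mod_self] at h
    exact Or.inr h
  · rw [Nat.mod_eq_of_lt h1] at h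
    exact Or.inl h

/-- A colouring of a regular polygon with at least three colours, in which the colours come in
increasing order, has no nontrivial dihedral symmetry: going around, there is exactly one step
from the last colour to the first, and none from the first to the last. -/
theorem symmetry_trivial {p : ℕ} {α : Type*} [LinearOrder α] (g : Fin p → α) (hg : Monotone g)
    (h3 : ∃ i j k, g i ≠ g j ∧ g j ≠ g k ∧ g i ≠ g k) (δ : Fin p → Fin p)
    (hδ : ∀ r, g (δ r) = g r) :
    (∀ k : ZMod p, (∀ r : Fin p, ((δ r : ℕ) : ZMod p) = (r : ℕ) + k) → k = 0) ∧
      ∀ k : ZMod p, ¬ ∀ r : Fin p, ((δ r : ℕ) : ZMod p) = k - (r : ℕ) := by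
  obtain ⟨i, j, k, hij, hjk, hik⟩ := h3
  have hp : 0 < p := i.pos
  set z : Fin p := ⟨0, hp⟩ with hz
  set l : Fin p := ⟨p - 1, by omega⟩ with hl
  have hzr : ∀ r, g z ≤ g r := fun r => hg (Fin.le_def.2 (Nat.zero_le _))
  have hrl : ∀ r, g r ≤ g l := fun r => hg (Fin.le_def.2 (by have := r.2; simp only [hl]; omega))
  obtain ⟨c, hzc, hcl⟩ : ∃ c, g z < g c ∧ g c < g l := by
    by_contra! hcon
    have hval : ∀ r, g r = g z ∨ g r = g l := by
      intro r
      rcases eq_or_lt_of_le (hzr r) with h | h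
      · exact Or.inl h.symm
      · exact Or.inr (le_antisymm (hrl r) (hcon r h))
    rcases hval i with h1 | h1 <;> rcases hval j with h2 | h2 <;> rcases hval k with h3 | h3 <;>
      simp_all
  have hzl : g z < g l := hzc.trans hcl
  have hlcast : ((l : ℕ) : ZMod p) = -1 := by
    rw [hl, Nat.cast_sub hp, ZMod.natCast_self]
    simp
  have hzcast : ((z : ℕ) : ZMod p) = 0 := by simp [hz]
  refine ⟨fun k hk => ?_, fun k hk => ?_⟩
  · have h1 : ((δ z : ℕ) : ZMod p) = (δ l : ℕ) + 1 := by
      rw [hk, hk, hlcast, hzcast]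
      ring
    rcases cast_eq_add_one (δ l).2 (δ z).2 h1 with h | h
    · have h2 : g (δ l) ≤ g (δ z) := hg (Fin.le_def.2 (by omega))
      rw [hδ, hδ] at h2
      exact absurd h2 (not_le.2 hzl)
    · have h2 := hk z
      rw [h, hzcast] at h2
      simpa using h2.symm
  · have h1 : ((δ l : ℕ) : ZMod p) = (δ z : ℕ) + 1 := by
      rw [hk, hk, hlcast, hzcast]
      ring
    rcases cast_eq_add_one (δ z).2 (δ l).2 h1 with h | h
    · rcases le_or_gt c (δ z) with hc | hc
      · have h2 := hg hc
        rw [hδ] at h2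
        exact absurd h2 (not_le.2 hzc)
      · have h2 : g (δ l) ≤ g c := hg (Fin.le_def.2 (by have := Fin.lt_def.1 hc; omega))
        rw [hδ] at h2
        exact absurd h2 (not_le.2 hcl)
    · have h2 : δ l = z := Fin.ext h
      have h3 := hδ l
      rw [h2] at h3
      exact absurd h3 hzl.ne

theorem youngHom_cyclicToYoung (m p : ℕ) (h : Subgroup.zpowers (finRotate (m * p) ^ p)) :
    youngHom (residueBlocks m p) (cyclicToYoung m p h) = h := by
  have := (MonoidHom.ofInjective (youngHom_injective (residueBlocks m p))).apply_symm_apply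
    (Subgroup.inclusion (zpowers_le_youngHom_range m p) h)
  exact congrArg Subtype.val this

/-- The elements of `⟨w_n ^ p⟩` are diagonal in `S_m^{×p}`. -/
theorem cyclicToYoung_const (m p : ℕ) (h : Subgroup.zpowers (finRotate (m * p) ^ p)) (i j : Fin p) :
    cyclicToYoung m p h i = cyclicToYoung m p h j := by
  obtain ⟨k, hk⟩ := Subgroup.mem_zpowers_iff.1 h.2
  have : cyclicToYoung m p h = (fun _ => finRotate m) ^ k := by
    apply youngHom_injective (residueBlocks m p)
    rw [youngHom_cyclicToYoung, map_zpow, youngHom_residueBlocks, hk]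
  rw [this]
  rfl

/-! ### Translates of outer tensor products of Specht modules -/

theorem groupSum_comm {G V W : Type*} [Group G] [Fintype G] [AddCommGroup V] [Module ℂ V]
    [AddCommGroup W] [Module ℂ W] {ρ : Representation ℂ G V} {σ : Representation ℂ G W}
    (f : V →ₗ[ℂ] W) (hf : ∀ g v, f (ρ g v) = σ g (f v)) (a : G → ℂ) (v : V) :
    groupSum σ a (f v) = f (groupSum ρ a v) := by
  simp only [groupSum_apply, map_sum, map_smul, hf]

/-- Commuting a product of central elements of the group algebras of the blocks past a permutation
`d` which permutes the blocks by `δ` permutes the factors by `δ`. -/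
theorem groupSum_youngHom_apply {n m p : ℕ} {W : Type*} [AddCommGroup W] [Module ℂ W]
    (σ : Representation ℂ (Perm (Fin n)) W) (e : Fin p × Fin m ≃ Fin n)
    (a : Fin p → Perm (Fin m) → ℂ) (ha : ∀ j c g, a j (c⁻¹ * g * c) = a j g)
    {d : Perm (Fin n)} {δ : Perm (Fin p)} {c : Fin p → Perm (Fin m)}
    (hd : ∀ j i, d (e (j, i)) = e (δ j, c j i)) (w : W) :
    groupSum (res (youngHom e) σ) (fun y => ∏ j, a j (y j)) (σ d w) =
      σ d (groupSum (res (youngHom e) σ) (fun y => ∏ j, a (δ j) (y j)) w) := by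
  rw [groupSum_apply, groupSum_apply, map_sum]
  refine Fintype.sum_bijective (fun y j => (c j)⁻¹ * y (δ j) * c j) ?_ _ _ fun y => ?_
  · rw [← Finite.injective_iff_bijective]
    intro y y' h
    funext j
    have h1 := congrFun h (δ.symm j)
    simpa using h1
  · have hprod : ∏ j, a (δ j) ((c j)⁻¹ * y (δ j) * c j) = ∏ j, a j (y j) := by
      simp only [ha]
      exact Equiv.prod_comp δ fun j => a j (y j)
    have hcomm : youngHom e y * d = d * youngHom e fun j => (c j)⁻¹ * y (δ j) * c j := by
      ext x
      obtain ⟨⟨j, i⟩, rfl⟩ := e.surjective x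
      simp [Perm.mul_apply, hd, youngHom_apply]
    rw [hprod, map_smul]
    congr 1
    change σ (youngHom e y) (σ d w) = σ d (σ (youngHom e _) w)
    rw [← Module.End.mul_apply, ← Module.End.mul_apply, ← map_mul, ← map_mul, hcomm]

/-- A permutation `δ` of the factors for which every `mu (δ j)` dominates `mu j` preserves `mu`. -/
theorem comp_eq_of_topCount_le {m : ℕ} {κ : Type*} [Fintype κ] (mu : κ → m.Partition)
    (δ : Perm κ) (h : ∀ j k, topCount (mu j) k ≤ topCount (mu (δ j)) k) (j : κ) :
    mu (δ j) = mu j := by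
  refine topCount_injective (funext fun k => Eq.symm ?_)
  exact (Finset.sum_eq_sum_iff_of_le fun j _ => h j k).1
    (Equiv.sum_comp δ fun j => topCount (mu j) k).symm j (Finset.mem_univ j)

/-- The embedding of the Young subgroup may be replaced by a conjugate one. -/
theorem isContained_res_youngHom {n m p : ℕ} {V W : Type*} [AddCommGroup V] [Module ℂ V]
    [AddCommGroup W] [Module ℂ W] {ρ : Representation ℂ (Fin p → Perm (Fin m)) V}
    {σ : Representation ℂ (Perm (Fin n)) W} (e e' : Fin p × Fin m ≃ Fin n)
    (h : IsContained ρ (res (youngHom e) σ)) : IsContained ρ (res (youngHom e') σ) := by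
  obtain ⟨f, hf⟩ := h
  refine ⟨⟨σ (e.symm.trans e') ∘ₗ f.toLinearMap, fun g => LinearMap.ext fun v => ?_⟩, ?_⟩
  · have h1 : f.toLinearMap (ρ g v) = σ (youngHom e g) (f.toLinearMap v) :=
      LinearMap.congr_fun (f.isIntertwining' g) v
    have hcomm : (e.symm.trans e' : Perm (Fin n)) * youngHom e g =
        youngHom e' g * (e.symm.trans e' : Perm (Fin n)) := by
      ext x
      obtain ⟨⟨j, i⟩, rfl⟩ := e.surjective x
      simp [Perm.mul_apply, youngHom_apply]
    change σ _ (f.toLinearMap (ρ g v)) = σ (youngHom e' g) (σ _ (f.toLinearMap v))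
    rw [h1, ← Module.End.mul_apply, ← Module.End.mul_apply, ← map_mul, ← map_mul, hcomm]
  · have hσ : Function.Injective (σ (e.symm.trans e')) := by
      refine Function.LeftInverse.injective (g := σ (e.symm.trans e')⁻¹) fun w => ?_
      rw [← Module.End.mul_apply, ← map_mul, inv_mul_cancel, map_one, Module.End.one_apply]
    exact hσ.comp hf

end DihedralRes

end

theorem proposition3p1 (m p : ℕ) (hodd : Odd (m * p)) (hp : p.Prime) (hm : 1 < m)
    (mu : Fin p → m.Partition)
    (hmu : ∃ i j k : Fin p, mu i ≠ mu j ∧ mu j ≠ mu k ∧ mu i ≠ mu k)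
    (lam : (m * p).Partition)
    (e : Fin p × Fin m ≃ Fin (m * p))
    (hlam : DihedralRes.IsContained
      (DihedralRes.outerTensor fun i => DihedralRes.spechtRep (mu i))
      (DihedralRes.res (DihedralRes.youngHom e) (DihedralRes.spechtRep lam))) :
    DihedralRes.IsContained
      (Representation.ind
        (Subgroup.inclusion (DihedralRes.zpowers_le_dihedral (m * p) p))
        (DihedralRes.res (DihedralRes.cyclicToYoung m p)
          (DihedralRes.outerTensor fun i => DihedralRes.spechtRep (mu i))))
      (DihedralRes.res (DihedralRes.dihedral (m * p)).subtype (DihedralRes.spechtRep lam)) := by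
  open DihedralRes in
  have : NeZero p := ⟨hp.ne_zero⟩
  have : NeZero m := ⟨by omega⟩
  -- Sorting the blocks leaves no dihedral symmetry of the colouring of the residue classes by
  -- partitions; any total order on the partitions of `m` will do.
  let key : m.Partition → ℕ := fun nu => (Fintype.equivFin _ nu : ℕ)
  have hkey : Function.Injective key := Fin.val_injective.comp (Equiv.injective _)
  set s : Equiv.Perm (Fin p) := Tuple.sort fun i => key (mu i)
  have hmono : Monotone fun r => key (mu (s r)) := Tuple.monotone_sort fun i => key (mu i)
  have h3 : ∃ i j k, key (mu (s i)) ≠ key (mu (s j)) ∧ key (mu (s j)) ≠ key (mu (s k)) ∧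
      key (mu (s i)) ≠ key (mu (s k)) := by
    obtain ⟨i, j, k, hij, hjk, hik⟩ := hmu
    refine ⟨s.symm i, s.symm j, s.symm k, ?_, ?_, ?_⟩ <;>
      simpa only [Equiv.apply_symm_apply, ne_eq, hkey.eq_iff]
  set e' : Fin p × Fin m ≃ Fin (m * p) :=
    (Equiv.prodCongr s.symm (Equiv.refl _)).trans (residueBlocks m p) with he'
  have he'_apply : ∀ r i, e' (s r, i) = residueBlocks m p (r, i) := fun r i => by simp [he']
  obtain ⟨f, hf⟩ := isContained_res_youngHom e e' hlam
  have hfY : ∀ y v, f.toLinearMap (outerTensor (fun i => spechtRep (mu i)) y v) =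
      res (youngHom e') (spechtRep lam) y (f.toLinearMap v) :=
    fun y v => LinearMap.congr_fun (f.isIntertwining' y) v
  -- Reordering the blocks does not affect the diagonal subgroup `⟨w_n ^ p⟩`.
  have hcyc : ∀ h, youngHom e' (cyclicToYoung m p h) = h := by
    intro h
    rw [← youngHom_cyclicToYoung m p h]
    ext x
    obtain ⟨⟨r, i⟩, rfl⟩ := (residueBlocks m p).surjective x
    rw [youngHom_apply, ← he'_apply, youngHom_apply,
      cyclicToYoung_const m p h _ r, he'_apply]
  refine isContained_ind _ (Subgroup.inclusion_injective _) f.toLinearMap (fun h v => ?_)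
    (groupSum (res (youngHom e') (spechtRep lam)) fun y => ∏ i, antisymmCoeff (mu i) (y i))
    (fun v hv => ?_) fun d hd v => ?_
  · refine (hfY _ v).trans ?_
    change spechtRep lam (youngHom e' (cyclicToYoung m p h)) _ = spechtRep lam h _
    rw [hcyc]
  · -- On the copy of `Ψ` itself, the product of the `∑ κ_T` acts injectively.
    rw [groupSum_comm _ hfY, groupSum_outerTensor] at hv
    have hinj := piTensorProduct_map_injective
      (fun i => groupSum (spechtRep (mu i)) (antisymmCoeff (mu i)))
      fun i => groupSum_spechtRep_injective (mu i)
    exact (map_eq_zero_iff _ hinj).1 ((map_eq_zero_iff f.toLinearMap hf).1 hv)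
  · -- On a translate, the factors are permuted by `δ'`, and some factor is annihilated.
    obtain ⟨δ, c, hδ, hdich⟩ := dihedral_blocks d.2
    set δ' : Equiv.Perm (Fin p) := (s.symm.trans δ).trans s with hδ'
    have hde' : ∀ j i, (d : Equiv.Perm (Fin (m * p))) (e' (j, i)) =
        e' (δ' j, c (s.symm j) i) := by
      intro j i
      obtain ⟨r, rfl⟩ := s.surjective j
      rw [he'_apply, hδ, hδ', ← he'_apply]
      simp
    have hcomm := groupSum_youngHom_apply (spechtRep lam) e' (fun i => antisymmCoeff (mu i))
      (fun i => antisymmCoeff_conj (mu i)) hde' (f.toLinearMap v)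
    refine hcomm.trans ?_
    rw [groupSum_comm _ hfY,
      groupSum_outerTensor _ fun j => antisymmCoeff (mu (δ' j))]
    suffices ∃ j, ¬ ∀ k, topCount (mu j) k ≤ topCount (mu (δ' j)) k by
      obtain ⟨j, hj⟩ := this
      rw [piTensorProduct_map_eq_zero
          (fun i => groupSum (spechtRep (mu i)) (antisymmCoeff (mu (δ' i)))) (i := j)
          (groupSum_spechtRep_eq_zero hj), LinearMap.zero_apply, map_zero, map_zero]
    by_contra! hdom
    have hfix : ∀ r, key (mu (s (δ r))) = key (mu (s r)) := by
      intro r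
      have h1 := comp_eq_of_topCount_le mu δ' hdom (s r)
      simpa [hδ'] using congrArg key h1
    obtain ⟨hrot, hrefl⟩ := symmetry_trivial (fun r => key (mu (s r))) hmono h3 δ hfix
    rcases hdich with ⟨k, hk, hmem⟩ | ⟨k, hk⟩
    · exact hd ⟨⟨d, hmem (hrot k hk)⟩, rfl⟩
    · exact hrefl k hk
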